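/- Let $K$ be a field of characteristic $0$ and let $q\in K^*$ be transcendental over $\mathbb{Q}$. Grade $R=K[x]$ by $\mathbb{Z}$ with $\deg x=1$ and let $\beta(n,m)=q^{nm}$, a bicharacter on $\mathbb{Z}$. For $a\in\mathbb{Z}$ let $\sigma_a$ be the $K$-linear map of $R$ with $\sigma_a(x^m)=\beta(a,m)x^m$, and for a $K$-linear map $\varphi:R\to R$ and $r\in R$ put $[\varphi,r]_a=\varphi\lambda_r-\lambda_{\sigma_a(r)}\varphi$, where $\lambda_r$ is multiplication by $r$. Let $D=D_q(K[x])=\bigcup_{i\ge 0}D_q^i(R)$ be the algebra of quantum differential operators on $R$. Here $D_q^{-1}(R)=0$ and, for $i\ge 0$, $D_q^i(R)$ is the $R$-subbimodule of $\operatorname{End}_K(R)$ (with $(r\varphi s)(t)=r\varphi(st)$) generated by the homogeneous $\varphi$ for which there is $a\in\mathbb{Z}$ with $[\varphi,r]_a\in D_q^{i-1}(R)$ for all $r\in R$. Write $x\in D$ for multiplication by $x$ and $\partial\in D$ for the derivative $d/dx$, and let $K[\partial]$ be the subalgebra of $D$ generated by $\partial$. Then the left $D$-module $D/Dx$ is simple.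 Moreover $D=Dx+K[\partial]$, and $D/Dx$ is identified with $K[\partial]$ as follows. Let $A_1=K\langle x,\partial:\partial x-x\partial=1\rangle$ be the first Weyl algebra, acting on the polynomial algebra $K[\partial]$ with $-x$ acting by differentiation with respect to $\partial$ and $\partial$ by left multiplication. This $A_1$-module is simple, and $f(\partial)\mapsto f(\partial)+Dx$ is a bijective $K$-linear map $K[\partial]\to D/Dx$ that is $A_1$-linear, where $A_1$ acts on $D/Dx$ through the algebra homomorphism $A_1\to D$ with $x\mapsto x$ and $\partial\mapsto\partial$. -/

import Mathlib

set_option maxSynthPendingDepth 3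

open Polynomial

noncomputable section

namespace QDiff

/-- A bicharacter `β : Γ × Γ → Kˣ` on an (additively written) abelian group `Γ`. -/
structure Bicharacter (Γ K : Type*) [AddCommGroup Γ] [Field K] where
  toFun : Γ → Γ → Kˣ
  map_add_left : ∀ a b c, toFun (a + b) c = toFun a c * toFun b c
  map_add_right : ∀ a b c, toFun a (b + c) = toFun a b * toFun a c

theorem Bicharacter.map_zero_left {Γ K : Type*} [AddCommGroup Γ] [Field K]
    (β : Bicharacter Γ K) (c : Γ) : β.toFun 0 c = 1 := by
  have h := β.map_add_left 0 0 c
  rw [add_zero] at h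
  exact left_eq_mul.mp h

section General

variable {Γ K R : Type*} [AddCommGroup Γ] [DecidableEq Γ] [Field K] [Ring R] [Algebra K R]
variable (𝒜 : Γ → Submodule K R) [GradedAlgebra 𝒜] (β : Bicharacter Γ K)

/-- The `K`-linear map `σ_a : R → R` with `σ_a r = β(a, d) r` for `r` homogeneous of degree `d`. -/
def sigma (a : Γ) : Module.End K R :=
  (DirectSum.toModule K Γ R (fun d => (β.toFun a d : K) • (𝒜 d).subtype)) ∘ₗ
    (DirectSum.decomposeLinearEquiv 𝒜).toLinearMap

theorem sigma_of_mem (a : Γ) {d : Γ} {r : R} (hr : r ∈ 𝒜 d) :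
    sigma 𝒜 β a r = (β.toFun a d : K) • r := by
  rw [sigma, LinearMap.comp_apply, LinearEquiv.coe_coe, DirectSum.decomposeLinearEquiv_apply,
    DirectSum.decompose_of_mem 𝒜 hr, ← DirectSum.lof_eq_of K, DirectSum.toModule_lof]
  rfl

theorem sigma_zero : sigma 𝒜 β 0 = 1 := by
  refine LinearMap.ext fun r => ?_
  induction r using DirectSum.Decomposition.inductionOn 𝒜 with
  | zero => simp
  | homogeneous r => simp [sigma_of_mem 𝒜 β 0 r.2, β.map_zero_left]
  | add r s hr hs => rw [map_add, hr, hs, map_add]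

theorem sigma_add (a b : Γ) (r : R) :
    sigma 𝒜 β (a + b) r = sigma 𝒜 β a (sigma 𝒜 β b r) := by
  induction r using DirectSum.Decomposition.inductionOn 𝒜 with
  | zero => simp
  | homogeneous r =>
    rw [sigma_of_mem 𝒜 β _ r.2, sigma_of_mem 𝒜 β _ r.2, map_smul, sigma_of_mem 𝒜 β _ r.2,
      β.map_add_left, smul_smul, Units.val_mul, mul_comm]
  | add r s hr hs => simp only [map_add, hr, hs]

/-- A `K`-linear map `φ : R → R` is homogeneous of some degree `d` if `φ (R_n) ⊆ R_{d + n}` for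
all `n`. -/
def IsHomog (φ : Module.End K R) : Prop :=
  ∃ d : Γ, ∀ n : Γ, ∀ r ∈ 𝒜 n, φ r ∈ 𝒜 (d + n)

/-- The twisted commutator `[φ, r]_a = φ r - σ_a(r) φ`, for the `R`-bimodule structure
`(r φ s)(t) = r φ(s t)` on linear maps `R → R`. -/
def twComm (a : Γ) (φ : Module.End K R) (r : R) : Module.End K R :=
  φ * LinearMap.mulLeft K r - LinearMap.mulLeft K (sigma 𝒜 β a r) * φ

/-- The sub-`R`-bimodule `R S R` generated by a set `S` of linear maps `R → R`. -/
def bimoduleSpan (S : Set (Module.End K R)) : Submodule K (Module.End K R) :=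
  Submodule.span K {ψ | ∃ r s : R, ∃ φ ∈ S,
    ψ = LinearMap.mulLeft K r * φ * LinearMap.mulLeft K s}

/-- The homogeneous `φ` for which some `a` satisfies `[φ, r]_a ∈ N` for all `r ∈ R`. -/
def twCommIn (N : Submodule K (Module.End K R)) : Set (Module.End K R) :=
  {φ | IsHomog 𝒜 φ ∧ ∃ a : Γ, ∀ r : R, twComm 𝒜 β a φ r ∈ N}

/-- The quantum differential operators of order `< n`. For `n = 1` this is the `R`-bimodule
generated by the quantum centre, and each further step is the `R`-bimodule generated by those
homogeneous `φ` that have, for some `a`, all `[φ, r]_a` in the previous step. -/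
def qdOrderLT : ℕ → Submodule K (Module.End K R)
  | 0 => ⊥
  | n + 1 => bimoduleSpan (twCommIn 𝒜 β (qdOrderLT n))

/-- `D_q^i(R)`, the `R`-bimodule of quantum differential operators of order `≤ i`. -/
def qdOrderLE (i : ℕ) : Submodule K (Module.End K R) := qdOrderLT 𝒜 β (i + 1)

theorem bimoduleSpan_mono {S T : Set (Module.End K R)} (h : S ⊆ T) :
    bimoduleSpan S ≤ bimoduleSpan T := by
  refine Submodule.span_mono ?_
  rintro _ ⟨r, s, φ, hφ, rfl⟩
  exact ⟨r, s, φ, h hφ, rfl⟩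

theorem subset_bimoduleSpan {S : Set (Module.End K R)} {φ : Module.End K R} (h : φ ∈ S) :
    φ ∈ bimoduleSpan S :=
  Submodule.subset_span ⟨1, 1, φ, h, by ext; simp⟩

theorem bimoduleSpan_mul_mem {S : Set (Module.End K R)} {φ : Module.End K R} (r s : R)
    (h : φ ∈ bimoduleSpan S) :
    LinearMap.mulLeft K r * φ * LinearMap.mulLeft K s ∈ bimoduleSpan S := by
  induction h using Submodule.span_induction with
  | mem ψ hψ =>
    obtain ⟨r', s', χ, hχ, rfl⟩ := hψ
    exact Submodule.subset_span ⟨r * r', s' * s, χ, hχ, by ext; simp [mul_assoc]⟩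
  | zero => simp
  | add ψ χ _ _ h1 h2 => rw [mul_add, add_mul]; exact add_mem h1 h2
  | smul c ψ _ h1 =>
    rw [mul_smul_comm, smul_mul_assoc]
    exact Submodule.smul_mem _ c h1

theorem qdOrderLT_bimodule {n : ℕ} {φ : Module.End K R} (r s : R)
    (h : φ ∈ qdOrderLT 𝒜 β n) :
    LinearMap.mulLeft K r * φ * LinearMap.mulLeft K s ∈ qdOrderLT 𝒜 β n := by
  cases n with
  | zero =>
    have h0 : φ = 0 := by simpa [qdOrderLT] using h
    simp [h0]
  | succ n => exact bimoduleSpan_mul_mem r s h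

theorem qdOrderLT_le_succ (n : ℕ) : qdOrderLT 𝒜 β n ≤ qdOrderLT 𝒜 β (n + 1) := by
  induction n with
  | zero => exact bot_le
  | succ n ih => exact bimoduleSpan_mono fun φ hφ => ⟨hφ.1, hφ.2.imp fun a ha r => ih (ha r)⟩

theorem qdOrderLT_mono : Monotone (qdOrderLT 𝒜 β) :=
  monotone_nat_of_le_succ (qdOrderLT_le_succ 𝒜 β)

set_option linter.unusedSectionVars false in
theorem isHomog_mul {φ ψ : Module.End K R} (hφ : IsHomog 𝒜 φ) (hψ : IsHomog 𝒜 ψ) :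
    IsHomog 𝒜 (φ * ψ) := by
  obtain ⟨d, hd⟩ := hφ
  obtain ⟨e, he⟩ := hψ
  refine ⟨d + e, fun n r hr => ?_⟩
  rw [add_assoc]
  exact hd _ _ (he n r hr)

theorem twComm_mul (a b : Γ) (φ ψ : Module.End K R) (r : R) :
    twComm 𝒜 β (a + b) (φ * ψ) r =
      φ * twComm 𝒜 β b ψ r + twComm 𝒜 β a φ (sigma 𝒜 β b r) * ψ := by
  simp only [twComm, sigma_add, mul_sub, sub_mul, mul_assoc]
  abel

/-- Products of operators of orders `≤ m` and `≤ n` have order `≤ m + n`. -/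
theorem qdOrderLT_mul (k : ℕ) : ∀ m n : ℕ, m + n ≤ k → ∀ φ ∈ qdOrderLT 𝒜 β (m + 1),
    ∀ ψ ∈ qdOrderLT 𝒜 β (n + 1), φ * ψ ∈ qdOrderLT 𝒜 β (m + n + 1) := by
  induction k using Nat.strong_induction_on with
  | _ k ih =>
  intro m n hmn φ hφ ψ hψ
  have low : ∀ m' n', m' + n' = m + n → ∀ φ' ∈ qdOrderLT 𝒜 β m',
      ∀ ψ' ∈ qdOrderLT 𝒜 β (n' + 1), φ' * ψ' ∈ qdOrderLT 𝒜 β (m + n) := by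
    intro m' n' h φ' hφ' ψ' hψ'
    cases m' with
    | zero =>
      have h0 : φ' = 0 := by simpa [qdOrderLT] using hφ'
      simp [h0]
    | succ m' =>
      have := ih (m' + n') (by omega) m' n' le_rfl φ' hφ' ψ' hψ'
      rwa [show m' + n' + 1 = m + n by omega] at this
  have low' : ∀ m' n', m' + n' = m + n → ∀ φ' ∈ qdOrderLT 𝒜 β (m' + 1),
      ∀ ψ' ∈ qdOrderLT 𝒜 β n', φ' * ψ' ∈ qdOrderLT 𝒜 β (m + n) := by
    intro m' n' h φ' hφ' ψ' hψ'
    cases n' with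
    | zero =>
      have h0 : ψ' = 0 := by simpa [qdOrderLT] using hψ'
      simp [h0]
    | succ n' =>
      have := ih (m' + n') (by omega) m' n' le_rfl φ' hφ' ψ' hψ'
      rwa [show m' + n' + 1 = m + n by omega] at this
  have gens : ∀ φ' ∈ twCommIn 𝒜 β (qdOrderLT 𝒜 β m), ∀ ψ' ∈ twCommIn 𝒜 β (qdOrderLT 𝒜 β n),
      φ' * ψ' ∈ qdOrderLT 𝒜 β (m + n + 1) := by
    intro φ' hφ' ψ' hψ'
    obtain ⟨h1, a, ha⟩ := id hφ'
    obtain ⟨h2, b, hb⟩ := id hψ'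
    refine subset_bimoduleSpan ⟨isHomog_mul 𝒜 h1 h2, a + b, fun r => ?_⟩
    rw [twComm_mul]
    exact add_mem (low' m n rfl φ' (subset_bimoduleSpan hφ') _ (hb r))
      (low m n rfl _ (ha _) ψ' (subset_bimoduleSpan hψ'))
  induction hφ using Submodule.span_induction with
  | zero => simp
  | add φ₁ φ₂ _ _ h1 h2 => rw [add_mul]; exact add_mem h1 h2
  | smul c φ₁ _ h1 => rw [smul_mul_assoc]; exact Submodule.smul_mem _ c h1
  | mem φ hφ =>
  obtain ⟨r, s, φ', hφ', rfl⟩ := hφ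
  induction hψ using Submodule.span_induction with
  | zero => simp
  | add φ₁ φ₂ _ _ h1 h2 => rw [mul_add]; exact add_mem h1 h2
  | smul c φ₁ _ h1 => rw [mul_smul_comm]; exact Submodule.smul_mem _ c h1
  | mem ψ hψ =>
  obtain ⟨t, u, ψ', hψ', rfl⟩ := hψ
  obtain ⟨h1, a, ha⟩ := id hφ'
  have e : LinearMap.mulLeft K r * φ' * LinearMap.mulLeft K s *
      (LinearMap.mulLeft K t * ψ' * LinearMap.mulLeft K u) =
      LinearMap.mulLeft K r * (LinearMap.mulLeft K (sigma 𝒜 β a (s * t)) * (φ' * ψ') *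
        LinearMap.mulLeft K 1 + twComm 𝒜 β a φ' (s * t) * ψ') * LinearMap.mulLeft K u := by
    simp only [twComm, LinearMap.mulLeft_mul, LinearMap.mulLeft_one, ← Module.End.mul_eq_comp,
      ← Module.End.one_eq_id, mul_sub, sub_mul, mul_add, add_mul, mul_assoc, one_mul]
    abel
  rw [e]
  refine qdOrderLT_bimodule 𝒜 β r u (add_mem ?_ ?_)
  · exact qdOrderLT_bimodule 𝒜 β _ _ (gens φ' hφ' ψ' hψ')
  · exact qdOrderLT_le_succ 𝒜 β _
      (low m n rfl _ (ha _) ψ' (subset_bimoduleSpan hψ'))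

theorem one_mem_qdOrderLE_zero : (1 : Module.End K R) ∈ qdOrderLE 𝒜 β 0 := by
  refine subset_bimoduleSpan ⟨⟨0, fun n r hr => by simpa using hr⟩, 0, fun r => ?_⟩
  simp [twComm, sigma_zero]

theorem mulLeft_mem_qdOrderLE_zero (r : R) : LinearMap.mulLeft K r ∈ qdOrderLE 𝒜 β 0 := by
  have h := qdOrderLT_bimodule 𝒜 β r 1 (one_mem_qdOrderLE_zero 𝒜 β)
  rwa [mul_one, LinearMap.mulLeft_one, ← Module.End.one_eq_id, mul_one] at h

/-- The algebra `D_q(R) = ⋃ᵢ D_q^i(R)` of quantum differential operators on `R`. -/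
def qdAlgebra : Subalgebra K (Module.End K R) where
  carrier := {φ | ∃ i, φ ∈ qdOrderLE 𝒜 β i}
  mul_mem' := by
    rintro φ ψ ⟨i, hi⟩ ⟨j, hj⟩
    exact ⟨i + j, qdOrderLT_mul 𝒜 β (i + j) i j le_rfl φ hi ψ hj⟩
  add_mem' := by
    rintro φ ψ ⟨i, hi⟩ ⟨j, hj⟩
    exact ⟨max i j, add_mem (qdOrderLT_mono 𝒜 β (by omega) hi)
      (qdOrderLT_mono 𝒜 β (by omega) hj)⟩
  algebraMap_mem' c := ⟨0, by
    rw [Algebra.algebraMap_eq_smul_one]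
    exact Submodule.smul_mem _ c (one_mem_qdOrderLE_zero 𝒜 β)⟩

end General

section Poly

variable {K : Type*} [Field K]

/-- The `ℤ`-grading of `K[x]` with `deg x = 1`: the component of degree `n` consists of the
scalar multiples of `x ^ n` (it is zero if `n < 0`). -/
def polyGrading (K : Type*) [Field K] (n : ℤ) : Submodule K K[X] where
  carrier := {p | ∀ k : ℕ, p.coeff k ≠ 0 → (k : ℤ) = n}
  zero_mem' := by simp
  add_mem' := by
    intro p r hp hr k hk
    by_cases h : p.coeff k = 0
    · exact hr k fun h' => hk (by simp [h, h'])
    · exact hp k h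
  smul_mem' := by
    intro c p hp k hk
    exact hp k fun h => hk (by simp [h])

theorem monomial_mem_polyGrading (k : ℕ) (c : K) : monomial k c ∈ polyGrading K k := by
  intro j hj
  rw [coeff_monomial] at hj
  split_ifs at hj with h
  · rw [h]
  · exact absurd rfl hj

theorem eq_monomial_of_mem {k : ℕ} {p : K[X]} (hp : p ∈ polyGrading K k) :
    p = monomial k (p.coeff k) := by
  ext j
  rw [coeff_monomial]
  split_ifs with h
  · rw [h]
  · by_contra h'
    exact h (by exact_mod_cast (hp j h').symm)

instance : SetLike.GradedMonoid (polyGrading K) where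
  one_mem := by simpa using monomial_mem_polyGrading (K := K) 0 1
  mul_mem := by
    intro i j p r hp hr k hk
    rw [coeff_mul] at hk
    obtain ⟨⟨a, b⟩, hab, h⟩ := Finset.exists_ne_zero_of_sum_ne_zero hk
    rw [Finset.HasAntidiagonal.mem_antidiagonal] at hab
    have h1 := hp a (left_ne_zero_of_mul h)
    have h2 := hr b (right_ne_zero_of_mul h)
    simp only at hab
    rw [← h1, ← h2, ← hab]
    push_cast
    rfl

instance : DirectSum.Decomposition (polyGrading K) :=
  DirectSum.Decomposition.ofLinearMap (polyGrading K)
    (Polynomial.lsum fun k : ℕ =>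
      (DirectSum.lof K ℤ (fun n => polyGrading K n) k) ∘ₗ
        (LinearMap.codRestrict (polyGrading K k) (monomial k) (monomial_mem_polyGrading k)))
    (by
      refine Polynomial.lhom_ext' fun k => LinearMap.ext fun c => ?_
      simp [Polynomial.lsum_apply, sum_monomial_index])
    (by
      refine DirectSum.linearMap_ext _ fun n => LinearMap.ext fun p => ?_
      obtain ⟨p, hp⟩ := p
      by_cases hn : 0 ≤ n
      · lift n to ℕ using hn
        have h := eq_monomial_of_mem hp
        generalize p.coeff n = c at h
        subst h
        simp [Polynomial.lsum_apply, sum_monomial_index]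
        rfl
      · have h0 : p = 0 := by
          ext k
          by_contra h
          exact hn (hp k h ▸ Int.natCast_nonneg k)
        subst h0
        have : (⟨0, hp⟩ : polyGrading K n) = 0 := rfl
        rw [this, map_zero, map_zero])

instance : GradedAlgebra (polyGrading K) where

/-- The bicharacter `β(n, m) = q ^ (n m)` on `ℤ`. -/
def qBicharacter (q : Kˣ) : Bicharacter ℤ K where
  toFun n m := q ^ (n * m)
  map_add_left a b c := by rw [add_mul, zpow_add]
  map_add_right a b c := by rw [mul_add, zpow_add]

/-- The algebra `D = D_q(K[x])`. -/
abbrev Dq (q : Kˣ) : Subalgebra K (Module.End K K[X]) :=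
  qdAlgebra (polyGrading K) (qBicharacter q)

/-- The element `x` of `D`: multiplication by `x` on `K[x]`. -/
def Dq.x (q : Kˣ) : Dq q :=
  ⟨LinearMap.mulLeft K X, 0, mulLeft_mem_qdOrderLE_zero _ _ X⟩

theorem derivative_mem (q : Kˣ) : (derivative : Module.End K K[X]) ∈ Dq q := by
  refine ⟨1, subset_bimoduleSpan ⟨⟨-1, ?_⟩, 0, fun r => ?_⟩⟩
  · intro n p hp k hk
    rw [coeff_derivative] at hk
    have h := hp (k + 1) (left_ne_zero_of_mul hk)
    push_cast at h
    omega
  · have h : twComm (polyGrading K) (qBicharacter q) 0 derivative r =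
        LinearMap.mulLeft K (derivative r) := by
      refine LinearMap.ext fun s => ?_
      simp [twComm, sigma_zero]
    rw [h]
    exact mulLeft_mem_qdOrderLE_zero _ _ _

/-- The element `∂` of `D`: the derivative on `K[x]`. -/
def Dq.del (q : Kˣ) : Dq q := ⟨derivative, derivative_mem q⟩

/-- The left ideal `D x` of `D`. -/
abbrev Dq.leftIdealX (q : Kˣ) : Submodule (Dq q) (Dq q) := Submodule.span (Dq q) {Dq.x q}

instance (q : Kˣ) : Ring (Dq q) := inferInstance

instance (q : Kˣ) : AddCommGroup (Dq q ⧸ Dq.leftIdealX q) := Submodule.Quotient.addCommGroup _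

instance (q : Kˣ) : Module (Dq q) (Dq q ⧸ Dq.leftIdealX q) := Submodule.Quotient.module _

instance (q : Kˣ) : SMul (Dq q) (Dq q ⧸ Dq.leftIdealX q) := Submodule.Quotient.instSMul _

instance (q : Kˣ) : Module K (Dq q ⧸ Dq.leftIdealX q) := Submodule.Quotient.module' _

end Poly

section Weyl

/-- The two generators of the first Weyl algebra. -/
inductive WeylGen
  | x
  | del

/-- The defining relation `∂ x = x ∂ + 1`. -/
inductive WeylRel (K : Type*) [Field K] :
    FreeAlgebra K WeylGen → FreeAlgebra K WeylGen → Prop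
  | comm : WeylRel K (FreeAlgebra.ι K WeylGen.del * FreeAlgebra.ι K WeylGen.x)
      (FreeAlgebra.ι K WeylGen.x * FreeAlgebra.ι K WeylGen.del + 1)

/-- The first Weyl algebra `A₁ = K⟨x, ∂ : ∂ x - x ∂ = 1⟩`. -/
abbrev WeylAlgebra (K : Type*) [Field K] : Type _ := RingQuot (WeylRel K)

variable {K : Type*} [Field K]

/-- The algebra map out of `A₁` given by `x ↦ u` and `∂ ↦ v`, where `v u = u v + 1`. -/
def weylLift {A : Type*} [Ring A] [Algebra K A] (u v : A) (h : v * u = u * v + 1) :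
    WeylAlgebra K →ₐ[K] A :=
  RingQuot.liftAlgHom K
    ⟨FreeAlgebra.lift K (fun g : WeylGen => match g with | .x => u | .del => v), by
      rintro _ _ ⟨⟩
      simpa using h⟩

/-- The algebra map `A₁ → D` with `x ↦ x` and `∂ ↦ ∂`. -/
def weylToDq (q : Kˣ) : WeylAlgebra K →ₐ[K] Dq q :=
  weylLift (Dq.x q) (Dq.del q) (by
    refine Subtype.ext (LinearMap.ext fun p => ?_)
    simp [Dq.x, Dq.del, add_comm])

/-- The polynomial algebra `K[∂]`, to be regarded as a left `A₁`-module; the variable of the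
underlying polynomial algebra is called `∂`. -/
def PolyDel (K : Type*) [Field K] : Type _ := K[X]

instance : AddCommGroup (PolyDel K) := inferInstanceAs (AddCommGroup K[X])

instance : Module K (PolyDel K) := inferInstanceAs (Module K K[X])

/-- The action of `A₁` on `K[∂]`: `-x` acts by differentiation with respect to `∂`, and `∂` acts
by left multiplication. -/
def weylAction (K : Type*) [Field K] : WeylAlgebra K →ₐ[K] Module.End K K[X] :=
  weylLift (-derivative) (LinearMap.mulLeft K X) (by
    refine LinearMap.ext fun p => ?_
    simp)

instance : Module (WeylAlgebra K) (PolyDel K) :=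
  Module.compHom K[X] (weylAction K).toRingHom

end Weyl

end QDiff

end

namespace QDiff

/-! ### Sequences annihilated by products of `E - q ^ a` -/

section Symbol

variable {K : Type*} [Field K]

/-! A homogeneous operator of degree `d` is a sequence `f` with `φ (x ^ n) = f n x ^ (n + d)`, and
its twisted commutator with `x` has symbol `(E - q ^ a) f`. Hence `D` is spanned by the homogeneous
operators whose symbol is killed by a product of factors `E - q ^ a` (`IsQExp.mem_Dq`,
`qdOrderLT_le_span`). As every `q ^ a` is nonzero, `E` is bijective on these sequences
(`exists_unshift`, `apply_zero_of_shift_eq_zero`).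

Right multiplication by `x` shifts the symbol, so membership in `D x` depends only on the value at
`0` of the unshifted symbol `g`. In degree `d > 0` there is no condition. In degree `-k ≤ 0` the
condition is `g 0 = 0`, and subtracting a multiple of `∂ ^ k` achieves it. This gives `D = D x +
K[∂]`, and also `1 ∉ D x`.

Since `x f(∂) ≡ -f'(∂)` modulo `D x`, the map `K[∂] → D / D x` is `A₁`-linear. In characteristic `0`
the Weyl algebra carries any nonzero polynomial to any other one. So `K[∂]` is simple, the map is
injective because `1 ∉ D x`, and the transitivity passes to `D / D x`. -/

/-- The operator `E - q ^ a` on sequences, where `E` is the shift. -/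
def shiftSub (q : Kˣ) (a : ℤ) (f : ℕ → K) : ℕ → K :=
  fun n => f (n + 1) - ((q ^ a : Kˣ) : K) * f n

/-- The sequences annihilated by some finite product of operators `E - q ^ a`. -/
inductive IsQExp (q : Kˣ) : (ℕ → K) → Prop
  | zero : IsQExp q 0
  | step (a : ℤ) (f : ℕ → K) : IsQExp q (shiftSub q a f) → IsQExp q f

namespace IsQExp

variable {q : Kˣ} {f g : ℕ → K}

theorem map (L : (ℕ → K) → ℕ → K) (h0 : L 0 = 0)
    (hL : ∀ a f, shiftSub q a (L f) = L (shiftSub q a f)) (hf : IsQExp q f) :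
    IsQExp q (L f) := by
  induction hf with
  | zero => rw [h0]; exact zero
  | step a f _ ih => exact step a _ (by rwa [hL])

theorem shiftSub (a : ℤ) (hf : IsQExp q f) : IsQExp q (shiftSub q a f) := by
  refine hf.map (QDiff.shiftSub q a) ?_ fun b f => ?_
  · funext n; simp [QDiff.shiftSub]
  · funext n; simp only [QDiff.shiftSub]; ring

theorem shift (hf : IsQExp q f) : IsQExp q (fun n => f (n + 1)) :=
  hf.map (fun f n => f (n + 1)) rfl fun _ _ => rfl

theorem const_mul (c : K) (hf : IsQExp q f) : IsQExp q (fun n => c * f n) := by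
  refine hf.map (fun f n => c * f n) ?_ fun b f => ?_
  · funext n; simp
  · funext n; simp only [QDiff.shiftSub]; ring

theorem add (hf : IsQExp q f) (hg : IsQExp q g) : IsQExp q (f + g) := by
  induction hf generalizing g with
  | zero => rwa [zero_add]
  | step a f _ ih =>
    refine step a _ ?_
    have h := ih (hg.shiftSub a)
    convert h using 1
    funext n
    simp only [QDiff.shiftSub, Pi.add_apply]
    ring

theorem sub_const_mul (c : K) (hf : IsQExp q f) (hg : IsQExp q g) :
    IsQExp q (fun n => f n - c * g n) := by
  convert hf.add (hg.const_mul (-c)) using 1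
  funext n
  simp [sub_eq_add_neg]

/-- Surjectivity of `E`: a recurrence with nonzero constant term can be run backwards by one step.
-/
theorem exists_unshift (hf : IsQExp q f) : ∃ g, IsQExp q g ∧ ∀ n, g (n + 1) = f n := by
  induction hf with
  | zero => exact ⟨0, zero, fun _ => rfl⟩
  | step a f _ ih =>
    obtain ⟨g, hg, h⟩ := ih
    have hq : ((q ^ a : Kˣ) : K) ≠ 0 := Units.ne_zero _
    -- The value at `0` solves `f 0 - q ^ a * y = g 0`, where `g` unshifts `(E - q ^ a) f`.
    refine ⟨fun n => Nat.casesOn n (((q ^ a : Kˣ) : K)⁻¹ * (f 0 - g 0)) f, step a _ ?_,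
      fun _ => rfl⟩
    convert hg using 1
    funext n
    cases n with
    | zero =>
      change f 0 - _ * (_⁻¹ * (f 0 - g 0)) = g 0
      rw [mul_inv_cancel_left₀ hq, sub_sub_cancel]
    | succ n => exact (h n).symm

/-- Injectivity of `E`. If `f` vanishes beyond `0`, so does `(E - q ^ a) f`, whose value at `0` is
`-q ^ a * f 0`. -/
theorem apply_zero_of_shift_eq_zero (hf : IsQExp q f) (h : ∀ n, f (n + 1) = 0) : f 0 = 0 := by
  induction hf with
  | zero => rfl
  | step a f _ ih =>
    have h1 := ih fun n => by simp [QDiff.shiftSub, h]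
    simpa [QDiff.shiftSub, h, -Units.val_zpow_eq_zpow_val] using h1

/-- The polynomial sequence `n ↦ (n - 1) (n - 2) ⋯ (n - k)`. -/
theorem prod_sub (k : ℕ) :
    IsQExp q (fun n : ℕ => ∏ i ∈ Finset.range k, ((n : K) - 1 - i)) := by
  induction k with
  | zero =>
    refine step 0 _ ?_
    convert zero using 1
    funext n
    simp [QDiff.shiftSub]
  | succ k ih =>
    -- With `a = 0` this is the forward difference, which lowers the product to `k + 1` times the
    -- one with `k` factors.
    refine step 0 _ ?_
    convert ih.const_mul ((k : K) + 1) using 1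
    funext n
    simp only [QDiff.shiftSub]
    rw [Finset.prod_range_succ', Finset.prod_range_succ]
    have : ∏ i ∈ Finset.range k, (((n + 1 : ℕ) : K) - 1 - ((i + 1 : ℕ) : K)) =
        ∏ i ∈ Finset.range k, ((n : K) - 1 - i) :=
      Finset.prod_congr rfl fun i _ => by push_cast; ring
    rw [this]
    push_cast
    simp
    ring

end IsQExp

/-! ### Homogeneous operators and their symbols -/

/-- `φ` is homogeneous of degree `d` with `φ (x ^ n) = f n x ^ (n + d)`. -/
def HasSymbol (φ : Module.End K K[X]) (d : ℤ) (f : ℕ → K) : Prop :=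
  ∀ n : ℕ, ((n : ℤ) + d < 0 → f n = 0) ∧ φ (X ^ n) = monomial ((n : ℤ) + d).toNat (f n)

theorem exists_hasSymbol (d : ℤ) (f : ℕ → K) (h : ∀ n : ℕ, (n : ℤ) + d < 0 → f n = 0) :
    ∃ φ, HasSymbol φ d f := by
  refine ⟨Polynomial.lsum fun n => f n • monomial ((n : ℤ) + d).toNat, fun n => ⟨h n, ?_⟩⟩
  rw [← monomial_one_right_eq_X_pow, Polynomial.lsum_apply, sum_monomial_index] <;>
    simp [smul_monomial]

theorem end_ext {φ ψ : Module.End K K[X]} (h : ∀ n : ℕ, φ (X ^ n) = ψ (X ^ n)) : φ = ψ := by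
  refine Polynomial.lhom_ext' fun n => LinearMap.ext_ring ?_
  simpa [monomial_one_right_eq_X_pow] using h n

theorem X_pow_mem_polyGrading (n : ℕ) : (X ^ n : K[X]) ∈ polyGrading K n := by
  rw [← monomial_one_right_eq_X_pow]; exact monomial_mem_polyGrading n 1

theorem sigma_X_pow (q : Kˣ) (a : ℤ) (n : ℕ) :
    sigma (polyGrading K) (qBicharacter q) a (X ^ n) = ((q ^ (a * n) : Kˣ) : K) • X ^ n :=
  sigma_of_mem _ _ _ (X_pow_mem_polyGrading n)

theorem sigma_X (q : Kˣ) (a : ℤ) :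
    sigma (polyGrading K) (qBicharacter q) a X = ((q ^ a : Kˣ) : K) • X := by
  simpa using sigma_X_pow q a 1

theorem IsHomog.exists_hasSymbol {φ : Module.End K K[X]} (h : IsHomog (polyGrading K) φ) :
    ∃ d f, HasSymbol φ d f := by
  obtain ⟨d, hd⟩ := h
  refine ⟨d, fun n => (φ (X ^ n)).coeff ((n : ℤ) + d).toNat, fun n => ?_⟩
  have hm := hd n _ (X_pow_mem_polyGrading n)
  by_cases hn : (n : ℤ) + d < 0
  · have h0 : φ (X ^ n) = 0 := by
      ext k
      by_contra hk
      have := hm k hk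
      omega
    simp [h0]
  · refine ⟨fun h => absurd h hn, eq_monomial_of_mem ?_⟩
    rwa [Int.toNat_of_nonneg (not_lt.mp hn), add_comm]

namespace HasSymbol

variable {q : Kˣ} {φ : Module.End K K[X]} {d : ℤ} {f : ℕ → K}

theorem isHomog (h : HasSymbol φ d f) : IsHomog (polyGrading K) φ := by
  refine ⟨d, fun n r hr => ?_⟩
  by_cases hn : 0 ≤ n
  · lift n to ℕ using hn
    rw [eq_monomial_of_mem hr, ← mul_one (r.coeff n), ← smul_eq_mul, ← smul_monomial,
      monomial_one_right_eq_X_pow, map_smul, (h n).2]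
    refine Submodule.smul_mem _ _ ?_
    by_cases hd : (n : ℤ) + d < 0
    · rw [(h n).1 hd, monomial_zero_right]; exact zero_mem _
    · convert monomial_mem_polyGrading ((n : ℤ) + d).toNat (f n) using 2
      omega
  · have : r = 0 := by
      ext k
      by_contra hk
      have := hr k hk
      omega
    rw [this, map_zero]
    exact zero_mem _

theorem twComm_X (h : HasSymbol φ d f) (a : ℤ) :
    HasSymbol (twComm (polyGrading K) (qBicharacter q) a φ X) (d + 1) (shiftSub q a f) := by
  intro n
  have h1 := h n
  have h2 := h (n + 1)
  refine ⟨fun hn => ?_, ?_⟩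
  · rw [shiftSub, h1.1 (by omega), h2.1 (by push_cast; omega)]
    simp
  · have e : twComm (polyGrading K) (qBicharacter q) a φ X (X ^ n) =
        φ (X ^ (n + 1)) - ((q ^ a : Kˣ) : K) • (X * φ (X ^ n)) := by
      simp [twComm, sigma_X, pow_succ']
    rw [e, h1.2, h2.2, X_mul_monomial, smul_monomial, shiftSub, map_sub, smul_eq_mul]
    have e1 : ((n + 1 : ℕ) + d : ℤ).toNat = ((n : ℤ) + (d + 1)).toNat := by push_cast; congr 1; ring
    rw [e1]
    -- `Int.toNat` truncates negative exponents, but then `f n = 0`.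
    by_cases hn : (n : ℤ) + d < 0
    · simp [h1.1 hn]
    · rw [show ((n : ℤ) + d).toNat + 1 = ((n : ℤ) + (d + 1)).toNat by omega]

theorem X_pow_mul (h : HasSymbol φ d f) (i : ℕ) :
    HasSymbol (LinearMap.mulLeft K (X ^ i) * φ) (d + i) f := by
  intro n
  refine ⟨fun hn => (h n).1 (by omega), ?_⟩
  rw [Module.End.mul_apply, (h n).2, LinearMap.mulLeft_apply, X_pow_mul_monomial]
  by_cases hn : (n : ℤ) + d < 0
  · simp [(h n).1 hn]
  · rw [show ((n : ℤ) + d).toNat + i = ((n : ℤ) + (d + i)).toNat by omega]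

theorem mul_X (h : HasSymbol φ d f) :
    HasSymbol (φ * LinearMap.mulLeft K X) (d + 1) (fun n => f (n + 1)) := by
  intro n
  refine ⟨fun hn => (h (n + 1)).1 (by push_cast; omega), ?_⟩
  rw [Module.End.mul_apply, LinearMap.mulLeft_apply, ← pow_succ', (h (n + 1)).2]
  rw [show ((n + 1 : ℕ) + d : ℤ) = (n : ℤ) + (d + 1) by push_cast; ring]

theorem ext {ψ : Module.End K K[X]} (h : HasSymbol φ d f) (h' : HasSymbol ψ d f) : φ = ψ :=
  end_ext fun n => (h n).2.trans (h' n).2.symm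

end HasSymbol

theorem hasSymbol_derivative_pow (k : ℕ) :
    HasSymbol ((derivative : Module.End K K[X]) ^ k) (-k) (fun n => (n.descFactorial k : K)) := by
  intro n
  constructor
  · intro h
    beta_reduce
    rw [Nat.descFactorial_eq_zero_iff_lt.mpr (by omega), Nat.cast_zero]
  · rw [Module.End.pow_apply, iterate_derivative_X_pow_eq_natCast_mul]
    rw [show ((n : ℤ) + -k).toNat = n - k by omega, ← C_mul_X_pow_eq_monomial]
    simp

/-- It suffices to test the commutator with the generator `x`, by linearity and a twisted Leibniz
rule. -/
theorem twComm_mem_of_X {q : Kˣ} {a : ℤ} {φ : Module.End K K[X]} {n : ℕ}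
    (h : twComm (polyGrading K) (qBicharacter q) a φ X ∈
      qdOrderLT (polyGrading K) (qBicharacter q) n) (r : K[X]) :
    twComm (polyGrading K) (qBicharacter q) a φ r ∈
      qdOrderLT (polyGrading K) (qBicharacter q) n := by
  induction r using Polynomial.induction_on' with
  | add p r hp hr =>
    convert add_mem hp hr using 1
    refine LinearMap.ext fun s => ?_
    simp [twComm, add_mul]
    abel
  | monomial k c =>
    rw [← mul_one c, ← smul_eq_mul, ← smul_monomial, monomial_one_right_eq_X_pow]
    have hc (p : K[X]) : twComm (polyGrading K) (qBicharacter q) a φ (c • p) =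
        c • twComm (polyGrading K) (qBicharacter q) a φ p := by
      refine LinearMap.ext fun s => ?_
      simp [twComm, smul_sub]
    rw [hc]
    refine Submodule.smul_mem _ _ ?_
    induction k with
    | zero =>
      have : twComm (polyGrading K) (qBicharacter q) a φ (X ^ 0) = 0 := by
        refine LinearMap.ext fun s => ?_
        simp only [twComm, sigma_X_pow]
        simp
      rw [this]
      exact zero_mem _
    | succ k ih =>
      -- Leibniz rule `[φ, r x]_a = [φ, r]_a x + σ_a(r) [φ, x]_a` at `r = x ^ k`.
      have e : twComm (polyGrading K) (qBicharacter q) a φ (X ^ (k + 1)) =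
          LinearMap.mulLeft K 1 * twComm (polyGrading K) (qBicharacter q) a φ (X ^ k) *
            LinearMap.mulLeft K X +
          LinearMap.mulLeft K (sigma (polyGrading K) (qBicharacter q) a (X ^ k)) *
            twComm (polyGrading K) (qBicharacter q) a φ X * LinearMap.mulLeft K 1 := by
        refine LinearMap.ext fun s => ?_
        simp only [twComm, sigma_X_pow, sigma_X]
        have : ((q ^ (a * ((k + 1 : ℕ) : ℤ)) : Kˣ) : K) =
            ((q ^ (a * (k : ℤ)) : Kˣ) : K) * ((q ^ a : Kˣ) : K) := by
          rw [← Units.val_mul, ← zpow_add]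
          push_cast
          rw [mul_add, mul_one]
        rw [this]
        simp only [mul_comm ((q ^ (a * (k : ℤ)) : Kˣ) : K)]
        simp [pow_succ, mul_sub, mul_assoc, smul_smul]
      rw [e]
      exact add_mem (qdOrderLT_bimodule _ _ _ _ ih) (qdOrderLT_bimodule _ _ _ _ h)

/-! ### Symbols of quantum differential operators -/

/-- Each factor `E - q ^ a` that kills the symbol accounts for one commutator, hence for at most one
more order. -/
theorem IsQExp.mem_Dq {q : Kˣ} {f : ℕ → K} (hf : IsQExp q f) {φ : Module.End K K[X]} {d : ℤ}
    (h : HasSymbol φ d f) : φ ∈ Dq q := by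
  suffices ∃ n, φ ∈ qdOrderLT (polyGrading K) (qBicharacter q) n by
    obtain ⟨n, hn⟩ := this
    exact ⟨n, qdOrderLT_le_succ _ _ n hn⟩
  induction hf generalizing φ d with
  | zero =>
    refine ⟨0, ?_⟩
    have : φ = 0 := end_ext fun n => by simp [(h n).2]
    rw [this]
    exact zero_mem _
  | step a f _ ih =>
    obtain ⟨n, hn⟩ := ih (h.twComm_X a)
    exact ⟨n + 1, subset_bimoduleSpan ⟨h.isHomog, a, twComm_mem_of_X hn⟩⟩

/-- The homogeneous operators whose symbol lies in the span of the sequences `n ^ j q ^ (a n)`. -/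
def qExpOps (q : Kˣ) : Set (Module.End K K[X]) := {φ | ∃ d f, IsQExp q f ∧ HasSymbol φ d f}

/-- The symbol of the degree `e` component of a linear map. -/
noncomputable def symbolAt (e : ℤ) (φ : Module.End K K[X]) (n : ℕ) : K :=
  if (n : ℤ) + e < 0 then 0 else (φ (X ^ n)).coeff ((n : ℤ) + e).toNat

theorem HasSymbol.symbolAt_eq {φ : Module.End K K[X]} {d : ℤ} {f : ℕ → K} (h : HasSymbol φ d f) :
    symbolAt d φ = f := by
  funext n
  rw [symbolAt]
  split_ifs with hn
  · exact ((h n).1 hn).symm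
  · rw [(h n).2, coeff_monomial_same]

theorem HasSymbol.symbolAt_ne {φ : Module.End K K[X]} {d e : ℤ} {f : ℕ → K}
    (h : HasSymbol φ d f) (hde : d ≠ e) : symbolAt e φ = 0 := by
  funext n
  rw [symbolAt]
  split_ifs with hn
  · rfl
  · rw [(h n).2, coeff_monomial, Pi.zero_apply]
    split_ifs with h'
    -- Distinct degrees give equal truncated exponents only if `n + d < 0`, where the symbol
    -- vanishes.
    · exact (h n).1 (by omega)
    · rfl

theorem isQExp_symbolAt {q : Kˣ} {φ : Module.End K K[X]}
    (h : φ ∈ Submodule.span K (qExpOps q)) (e : ℤ) : IsQExp q (symbolAt e φ) := by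
  induction h using Submodule.span_induction with
  | mem φ hφ =>
    obtain ⟨d, f, hf, h⟩ := hφ
    by_cases hde : d = e
    · subst hde; rwa [h.symbolAt_eq]
    · rw [h.symbolAt_ne hde]; exact .zero
  | zero =>
    convert IsQExp.zero using 1
    funext n; simp [symbolAt]
  | add φ ψ _ _ h1 h2 =>
    convert h1.add h2 using 1
    funext n
    simp only [symbolAt, Pi.add_apply]
    split_ifs <;> simp
  | smul c φ _ h =>
    convert h.const_mul c using 1
    funext n
    simp only [symbolAt]
    split_ifs <;> simp

theorem span_qExpOps_bimodule {q : Kˣ} {φ : Module.End K K[X]} (r s : K[X])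
    (h : φ ∈ qExpOps q) :
    LinearMap.mulLeft K r * φ * LinearMap.mulLeft K s ∈ Submodule.span K (qExpOps q) := by
  have right (φ : Module.End K K[X]) (h : φ ∈ qExpOps q) (j : ℕ) :
      φ * LinearMap.mulLeft K (X ^ j) ∈ qExpOps q := by
    induction j generalizing φ with
    | zero => simpa [← Module.End.one_eq_id] using h
    | succ j ih =>
      obtain ⟨d, f, hf, h⟩ := h
      rw [pow_succ', LinearMap.mulLeft_mul, ← Module.End.mul_eq_comp, ← mul_assoc]
      exact ih _ ⟨_, _, hf.shift, h.mul_X⟩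
  have hmon (j : ℕ) (c : K) : LinearMap.mulLeft K (monomial j c : K[X]) =
      c • LinearMap.mulLeft K (X ^ j : K[X]) := by
    refine LinearMap.ext fun p => ?_
    simp [← C_mul_X_pow_eq_monomial, smul_eq_C_mul]
  have hadd (p r : K[X]) : LinearMap.mulLeft K (p + r) =
      LinearMap.mulLeft K p + LinearMap.mulLeft K r := by
    refine LinearMap.ext fun s => ?_
    simp [add_mul]
  induction r using Polynomial.induction_on' with
  | add p r hp hr => rw [hadd, add_mul, add_mul]; exact add_mem hp hr
  | monomial i c =>
  induction s using Polynomial.induction_on' with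
  | add p r hp hr => rw [hadd, mul_add]; exact add_mem hp hr
  | monomial j c' =>
    rw [hmon, hmon, smul_mul_assoc, smul_mul_assoc, mul_smul_comm]
    refine Submodule.smul_mem _ _ (Submodule.smul_mem _ _ (Submodule.subset_span ?_))
    obtain ⟨d, f, hf, h⟩ := h
    exact right _ ⟨_, f, hf, h.X_pow_mul i⟩ j

/-- For a homogeneous generator, `[φ, x]_a` lies in the span by induction. Its symbol is `(E - q ^
a) f`, so `f` needs just one more factor. -/
theorem qdOrderLT_le_span (q : Kˣ) (n : ℕ) :
    qdOrderLT (polyGrading K) (qBicharacter q) n ≤ Submodule.span K (qExpOps q) := by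
  induction n with
  | zero => exact bot_le
  | succ n ih =>
    refine Submodule.span_le.mpr ?_
    rintro _ ⟨r, s, φ, ⟨h, a, ha⟩, rfl⟩
    obtain ⟨d, f, hf⟩ := h.exists_hasSymbol
    refine span_qExpOps_bimodule r s ⟨d, f, .step a f ?_, hf⟩
    rw [← (hf.twComm_X (q := q) a).symbolAt_eq]
    exact isQExp_symbolAt (ih (ha X)) _

theorem mem_span_of_mem_Dq {q : Kˣ} {φ : Module.End K K[X]} (h : φ ∈ Dq q) :
    φ ∈ Submodule.span K (qExpOps q) := by
  obtain ⟨i, hi⟩ := h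
  exact qdOrderLT_le_span q _ hi

end Symbol

end QDiff

namespace QDiff

/-! ### The left ideal `D x` and its complement -/

section Simple

variable {K : Type*} [Field K]

noncomputable instance (q : Kˣ) : MulAction (Dq q) (Dq q ⧸ Dq.leftIdealX q) :=
  (inferInstance : Module (Dq q) (Dq q ⧸ Dq.leftIdealX q)).toMulAction

theorem mem_leftIdealX_iff {q : Kˣ} {φ : Dq q} :
    φ ∈ Dq.leftIdealX q ↔ ∃ ψ : Dq q, ψ * Dq.x q = φ :=
  Submodule.mem_span_singleton

theorem symbolAt_mul_X (φ : Module.End K K[X]) (e : ℤ) (n : ℕ) :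
    symbolAt (e + 1) (φ * LinearMap.mulLeft K X) n = symbolAt e φ (n + 1) := by
  have h : (n : ℤ) + (e + 1) = ((n + 1 : ℕ) : ℤ) + e := by push_cast; ring
  rw [symbolAt, symbolAt, h, Module.End.mul_apply, LinearMap.mulLeft_apply, ← pow_succ']

/-- If `ψ x = 1`, the degree `-1` symbol of `ψ` equals `1` at every `n ≥ 1`, which forces the value
`1` at `0`. That value is `0`, since no `x ^ (-1)` exists. -/
theorem one_notMem_leftIdealX (q : Kˣ) : (1 : Dq q) ∉ Dq.leftIdealX q := by
  rw [mem_leftIdealX_iff]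
  rintro ⟨ψ, h⟩
  have hψ := isQExp_symbolAt (mem_span_of_mem_Dq ψ.2) (-1)
  have h1 (n : ℕ) : symbolAt (-1) ψ.1 (n + 1) = 1 := by
    rw [← symbolAt_mul_X]
    have e : ψ.1 * LinearMap.mulLeft K X = 1 := congrArg Subtype.val h
    simp [e, symbolAt, coeff_X_pow]
  have h2 : IsQExp q (fun n : ℕ => ∏ i ∈ Finset.range 0, ((n : K) - 1 - i)) := .prod_sub 0
  have h3 := (hψ.sub_const_mul 1 h2).apply_zero_of_shift_eq_zero fun n => by simp [h1]
  simp [symbolAt] at h3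

/-- The unshifted symbol defines a left factor of `x` unless it is nonzero at `0` in degree `d ≤ 0`;
a multiple of `∂ ^ (-d)` corrects that single value. -/
theorem hasSymbol_mem_sup [CharZero K] {q : Kˣ} {φ : Dq q} {d : ℤ} {f : ℕ → K}
    (hf : IsQExp q f) (h : HasSymbol φ.1 d f) :
    φ ∈ (Dq.leftIdealX q).restrictScalars K ⊔
      Subalgebra.toSubmodule (Algebra.adjoin K {Dq.del q}) := by
  obtain ⟨g, hg, hgf⟩ := hf.exists_unshift
  have lift (g : ℕ → K) (hg : IsQExp q g) (χ : Dq q)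
      (h : HasSymbol χ.1 d fun n => g (n + 1)) (h0 : d ≤ 0 → g 0 = 0) :
      χ ∈ Dq.leftIdealX q := by
    have hgd (n : ℕ) (hn : (n : ℤ) + (d - 1) < 0) : g n = 0 := by
      cases n with
      | zero => exact h0 (by push_cast at hn; omega)
      | succ n => exact (h n).1 (by push_cast at hn; omega)
    obtain ⟨ψ, hψ⟩ := exists_hasSymbol (d - 1) g hgd
    refine mem_leftIdealX_iff.mpr ⟨⟨ψ, hg.mem_Dq hψ⟩, Subtype.ext ?_⟩
    have := hψ.mul_X
    rw [sub_add_cancel] at this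
    exact this.ext h
  have hgf' : f = fun n => g (n + 1) := funext fun n => (hgf n).symm
  subst hgf'
  rcases lt_or_ge 0 d with hd | hd
  · exact Submodule.mem_sup_left (lift g hg φ h fun h' => absurd hd (not_lt.mpr h'))
  obtain ⟨k, rfl⟩ : ∃ k : ℕ, d = -k := ⟨(-d).toNat, by omega⟩
  set b : ℕ → K := fun n => ∏ i ∈ Finset.range k, ((n : K) - 1 - i) with hb
  -- `b` is the unshifted symbol of `∂ ^ k`, and `b 0 = (-1) ^ k * k!` is nonzero in characteristic
  -- `0`.
  have hb0 : b 0 ≠ 0 := by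
    refine Finset.prod_ne_zero_iff.mpr fun i _ h => ?_
    have : ((i + 1 : ℕ) : K) = 0 := by
      push_cast at h ⊢
      linear_combination -h
    exact Nat.cast_ne_zero.mpr i.succ_ne_zero this
  have hbs (n : ℕ) : b (n + 1) = (n.descFactorial k : K) := by
    rw [← descPochhammer_eval_eq_descFactorial, descPochhammer_eval_eq_prod_range]
    simp [hb]
  -- This choice makes `g - c * b` vanish at `0`.
  set c := g 0 / b 0
  have hmem := lift _ (hg.sub_const_mul c (IsQExp.prod_sub k)) (φ - c • Dq.del q ^ k) (by
    intro n
    obtain ⟨h1, h1'⟩ := h n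
    obtain ⟨h2, h2'⟩ := hasSymbol_derivative_pow (K := K) k n
    beta_reduce at h1 h1' h2 h2'
    change (_ → g (n + 1) - c * b (n + 1) = 0) ∧ _ = monomial _ (g (n + 1) - c * b (n + 1))
    rw [hbs]
    refine ⟨fun hn => by rw [h1 hn, h2 hn, mul_zero, sub_zero], ?_⟩
    change φ.1 (X ^ n) - c • (derivative ^ k : Module.End K K[X]) (X ^ n) = _
    rw [h1', h2', smul_monomial, ← map_sub, smul_eq_mul]) (fun _ => by
    change g 0 - g 0 / b 0 * b 0 = 0
    rw [div_mul_cancel₀ _ hb0, sub_self])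
  rw [← sub_add_cancel φ (c • Dq.del q ^ k)]
  exact Submodule.add_mem_sup hmem
    (Subalgebra.smul_mem _ (pow_mem (Algebra.self_mem_adjoin_singleton K _) k) c)

theorem leftIdealX_sup_adjoin_del [CharZero K] (q : Kˣ) :
    (Dq.leftIdealX q).restrictScalars K ⊔
      Subalgebra.toSubmodule (Algebra.adjoin K {Dq.del q}) = ⊤ := by
  set N := (Dq.leftIdealX q).restrictScalars K ⊔
      Subalgebra.toSubmodule (Algebra.adjoin K {Dq.del q}) with hN
  refine eq_top_iff.mpr fun φ _ => ?_
  have h : φ.1 ∈ N.map (Dq q).val.toLinearMap := by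
    refine Submodule.span_le.mpr ?_ (mem_span_of_mem_Dq φ.2)
    rintro ψ ⟨d, f, hf, h⟩
    exact ⟨⟨ψ, hf.mem_Dq h⟩, hasSymbol_mem_sup hf h, rfl⟩
  obtain ⟨ψ, hψ, h⟩ := h
  rwa [← Subtype.ext h]

/-- The map `f ↦ f(∂) + D x` from `K[∂]` to `D / D x`. -/
noncomputable def polyDelToQuotient (q : Kˣ) : K[X] →ₗ[K] (Dq q ⧸ Dq.leftIdealX q) :=
  ((Dq.leftIdealX q).mkQ.restrictScalars K) ∘ₗ (aeval (Dq.del q)).toLinearMap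

theorem polyDelToQuotient_apply (q : Kˣ) (f : K[X]) :
    polyDelToQuotient q f = (Dq.leftIdealX q).mkQ (aeval (Dq.del q) f) := rfl

theorem polyDelToQuotient_surjective [CharZero K] (q : Kˣ) :
    Function.Surjective (polyDelToQuotient q) := by
  intro m
  obtain ⟨φ, rfl⟩ := (Dq.leftIdealX q).mkQ_surjective m
  have hφ : φ ∈ (Dq.leftIdealX q).restrictScalars K ⊔
      Subalgebra.toSubmodule (Algebra.adjoin K {Dq.del q}) := by
    rw [leftIdealX_sup_adjoin_del]; trivial
  obtain ⟨y, hy, z, hz, rfl⟩ := Submodule.mem_sup.mp hφ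
  rw [Algebra.adjoin_singleton_eq_range_aeval] at hz
  obtain ⟨f, rfl⟩ := hz
  refine ⟨f, ?_⟩
  have h0 : (Dq.leftIdealX q).mkQ y = 0 := (Submodule.Quotient.mk_eq_zero _).mpr hy
  rw [map_add, h0, zero_add]
  rfl

/-! ### The Weyl algebra action and simplicity -/

/-- The generators `x` and `∂` of the Weyl algebra. -/
noncomputable def weylGen (K : Type*) [Field K] (g : WeylGen) : WeylAlgebra K :=
  RingQuot.mkAlgHom K (WeylRel K) (FreeAlgebra.ι K g)

theorem weylLift_gen_x {A : Type*} [Ring A] [Algebra K A] (u v : A) (h : v * u = u * v + 1) :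
    weylLift u v h (weylGen K .x) = u := by
  simp [weylLift, weylGen]

theorem weylLift_gen_del {A : Type*} [Ring A] [Algebra K A] (u v : A) (h : v * u = u * v + 1) :
    weylLift u v h (weylGen K .del) = v := by
  simp [weylLift, weylGen]

theorem weylAction_x (f : K[X]) : weylAction K (weylGen K .x) f = -derivative f := by
  rw [weylAction, weylLift_gen_x]; rfl

theorem weylAction_del (f : K[X]) : weylAction K (weylGen K .del) f = X * f := by
  rw [weylAction, weylLift_gen_del]; rfl

/-- Modulo `D x` this reads `x f(∂) ≡ -f'(∂)`, the source of the sign in the action on `K[∂]`. -/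
theorem aeval_del_mul_x (q : Kˣ) (f : K[X]) :
    aeval (Dq.del q) f * Dq.x q =
      Dq.x q * aeval (Dq.del q) f + aeval (Dq.del q) (derivative f) := by
  have comm : Dq.del q * Dq.x q = Dq.x q * Dq.del q + 1 := by
    refine Subtype.ext (LinearMap.ext fun p => ?_)
    simp [Dq.x, Dq.del, add_comm]
  induction f using Polynomial.induction_on with
  | C a => simp [Algebra.commutes]
  | add p r hp hr => simp only [map_add, add_mul, mul_add, hp, hr]; abel
  | monomial n a ih =>
    have e : (C a * X ^ (n + 1) : K[X]) = C a * X ^ n * X := by rw [pow_succ, mul_assoc]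
    rw [e]
    generalize (C a * X ^ n : K[X]) = p at ih ⊢
    rw [derivative_mul, derivative_X, mul_one, map_mul, aeval_X, mul_assoc, comm, mul_add,
      mul_one, ← mul_assoc, ih, map_add, map_mul, aeval_X, add_mul, mul_assoc, add_assoc]

theorem polyDelToQuotient_smul (q : Kˣ) (w : WeylAlgebra K) (f : K[X]) :
    polyDelToQuotient q (weylAction K w f) = weylToDq q w • polyDelToQuotient q f := by
  obtain ⟨w, rfl⟩ := RingQuot.mkAlgHom_surjective K (WeylRel K) w
  induction w using FreeAlgebra.induction generalizing f with
  | grade0 c =>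
    rw [AlgHom.commutes, AlgHom.commutes, AlgHom.commutes,
      Module.algebraMap_end_apply, map_smul, algebraMap_smul]
  | grade1 g =>
    change polyDelToQuotient q (weylAction K (weylGen K g) f) = weylToDq q (weylGen K g) • _
    cases g with
    | x =>
      rw [weylAction_x, weylToDq, weylLift_gen_x, polyDelToQuotient_apply, polyDelToQuotient_apply, ← map_smul, smul_eq_mul,
        ← sub_eq_zero, ← map_sub]
      refine (Submodule.Quotient.mk_eq_zero _).mpr (mem_leftIdealX_iff.mpr
        ⟨-aeval (Dq.del q) f, ?_⟩)
      rw [neg_mul, aeval_del_mul_x, map_neg]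
      abel
    | del =>
      rw [weylAction_del, weylToDq, weylLift_gen_del, polyDelToQuotient_apply, polyDelToQuotient_apply, ← map_smul, smul_eq_mul,
        map_mul, aeval_X]
  | mul a b ha hb =>
    rw [map_mul, map_mul, map_mul, Module.End.mul_apply, ha, hb, mul_smul]
  | add a b ha hb =>
    rw [map_add, map_add, map_add, LinearMap.add_apply, map_add, ha, hb]
    exact (Module.add_smul _ _ _).symm

theorem mem_weyl_span_C {c : K} (hc : c ≠ 0) (g : K[X]) :
    ∃ w : WeylAlgebra K, weylAction K w (C c) = g := by
  refine ⟨aeval (weylGen K .del) (C c⁻¹ * g), ?_⟩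
  rw [← aeval_algHom_apply]
  have h (p : K[X]) (r : K[X]) : aeval (weylAction K (weylGen K .del)) p r = p * r := by
    induction p using Polynomial.induction_on with
    | C a => simp [smul_eq_C_mul]
    | add p r hp hr => rw [map_add, LinearMap.add_apply, hp, hr, add_mul]
    | monomial n a ih =>
      rw [pow_succ', mul_left_comm, map_mul, aeval_X, Module.End.mul_apply, ih, weylAction_del,
        ← mul_assoc]
  rw [h, mul_comm (C c⁻¹), mul_assoc, ← C_mul, inv_mul_cancel₀ hc, C_1, mul_one]

/-- Acting by `x` differentiates up to sign, so in characteristic `0` repeated action reduces `f` to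
a nonzero constant; a polynomial in `∂` then produces `g`. -/
theorem exists_weylAction_eq [CharZero K] {f : K[X]} (hf : f ≠ 0) (g : K[X]) :
    ∃ w : WeylAlgebra K, weylAction K w f = g := by
  induction hn : f.natDegree using Nat.strong_induction_on generalizing f with
  | _ n ih =>
  by_cases hd : derivative f = 0
  · rw [eq_C_of_derivative_eq_zero hd] at hf ⊢
    exact mem_weyl_span_C (fun h => hf (by rw [h, C_0])) g
  · have hlt : (-derivative f).natDegree < n := by
      rw [natDegree_neg, ← hn]
      exact natDegree_derivative_lt fun h => hd (by
        rw [eq_C_of_natDegree_eq_zero h, derivative_C])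
    obtain ⟨w, hw⟩ := ih _ hlt (neg_ne_zero.mpr hd) rfl
    exact ⟨w * weylGen K .x, by rw [map_mul, Module.End.mul_apply, weylAction_x, hw]⟩

instance : Nontrivial (PolyDel K) := inferInstanceAs (Nontrivial K[X])

theorem isSimpleModule_polyDel [CharZero K] : IsSimpleModule (WeylAlgebra K) (PolyDel K) :=
  isSimpleModule_iff_toSpanSingleton_surjective.mpr
    ⟨inferInstance, fun _ hf g => exists_weylAction_eq hf g⟩

theorem nontrivial_quotient (q : Kˣ) : Nontrivial (Dq q ⧸ Dq.leftIdealX q) :=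
  Submodule.Quotient.nontrivial_iff.mpr fun h =>
    one_notMem_leftIdealX q (by rw [h]; trivial)

theorem polyDelToQuotient_injective [CharZero K] (q : Kˣ) :
    Function.Injective (polyDelToQuotient q) := by
  refine (injective_iff_map_eq_zero _).mpr fun f h0 => ?_
  by_contra hf
  -- A nonzero `f` in the kernel could be moved to `1`, which would put `1` in `D x`.
  obtain ⟨w, hw⟩ := exists_weylAction_eq hf (1 : K[X])
  have h := polyDelToQuotient_smul q w f
  rw [h0, smul_zero, hw, polyDelToQuotient_apply, map_one] at h
  exact one_notMem_leftIdealX q ((Submodule.Quotient.mk_eq_zero _).mp h)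

/-- The image of `A₁` in `D` already carries any nonzero class to any other class. -/
theorem isSimpleModule_quotient [CharZero K] (q : Kˣ) :
    IsSimpleModule (Dq q) (Dq q ⧸ Dq.leftIdealX q) := by
  refine isSimpleModule_iff_toSpanSingleton_surjective.mpr
    ⟨nontrivial_quotient q, fun m hm m' => ?_⟩
  obtain ⟨f, rfl⟩ := polyDelToQuotient_surjective q m
  obtain ⟨g, rfl⟩ := polyDelToQuotient_surjective q m'
  have hf : f ≠ 0 := fun h => hm (by rw [h, map_zero])
  obtain ⟨w, hw⟩ := exists_weylAction_eq hf g
  refine ⟨weylToDq q w, ?_⟩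
  rw [LinearMap.toSpanSingleton_apply, ← polyDelToQuotient_smul, hw]

end Simple

end QDiff

theorem mainTheorem7 {K : Type*} [Field K] [CharZero K] (q : Kˣ)
    (hq : Transcendental ℚ (q : K)) :
    IsSimpleModule (QDiff.Dq q) (QDiff.Dq q ⧸ QDiff.Dq.leftIdealX q) ∧
    (QDiff.Dq.leftIdealX q).restrictScalars K ⊔
      Subalgebra.toSubmodule (Algebra.adjoin K {QDiff.Dq.del q}) = ⊤ ∧
    IsSimpleModule (QDiff.WeylAlgebra K) (QDiff.PolyDel K) ∧
    ∃ e : QDiff.PolyDel K ≃ₗ[K] (QDiff.Dq q ⧸ QDiff.Dq.leftIdealX q),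
      (∀ f : Polynomial K,
        e f = (QDiff.Dq.leftIdealX q).mkQ (Polynomial.aeval (QDiff.Dq.del q) f)) ∧
      (∀ (w : QDiff.WeylAlgebra K) (f : QDiff.PolyDel K),
        e (w • f) = QDiff.weylToDq q w • e f) :=
  ⟨QDiff.isSimpleModule_quotient q, QDiff.leftIdealX_sup_adjoin_del q,
    QDiff.isSimpleModule_polyDel,
    LinearEquiv.ofBijective (QDiff.polyDelToQuotient q)
      ⟨QDiff.polyDelToQuotient_injective q, QDiff.polyDelToQuotient_surjective q⟩,
    fun _ => rfl, QDiff.polyDelToQuotient_smul q⟩
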